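/- Notation. For a compact metric space $X$ let $\mathcal M(X)$ be the space of finite real Borel (Radon) measures with the total variation norm $\|\cdot\|_{\mathcal M}$, $\mathcal M_+(X)$ its nonnegative elements, and $f_\#\nu$ the pushforward of $\nu$ under $f$; zero extension is used to view measures on larger sets. Setting. Let $\Omega\subset\mathbb R^d$, $\Sigma\subset\mathbb R$ and $\Theta\subset S^{d-1}$ be compact, let $\mathcal T\subset\Sigma$ be finite, and let $\mathcal H_\Theta$ be a Borel probability measure on $\Theta$. Put $\Lambda=\{(x,v)\in\mathbb R^d\times\mathbb R^d : x+tv\in\Omega\ \forall t\in\Sigma\}$ and $\Gamma=\{(\theta\cdot x,\theta\cdot v) : (x,v)\in\Lambda,\ \theta\in\Theta\}\subset\mathbb R^2$. Define $R_\theta\nu=[x\mapsto\theta\cdot x]_\#\nu$, $R^2_\theta\lambda=[(x,v)\mapsto(\theta\cdot x,\theta\cdot v)]_\#\lambda$ and $M^n_t\lambda=[(x,v)\mapsto x+tv]_\#\lambda$ for measures $\lambda$ on $\mathbb R^n\times\mathbb R^n$. Let $H$ be a Hilbert space and, for each $t$, let $\mathrm{Ob}_t:\mathcal M(\Omega)\to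 H$ be linear and dual to a bounded linear operator $\mathrm{Ob}_t^*:H\to C(\Omega)$. Ground truth. Let $\lambda^\dagger=\sum_{i=1}^N m_i\delta_{(x_i,v_i)}$ with $m_i\ge0$ and $(x_i,v_i)\in\Lambda$, and put $u_t^\dagger=M_t^d\lambda^\dagger$, $\gamma_\theta^\dagger=R^2_\theta\lambda^\dagger$, $f_t^\dagger=\mathrm{Ob}_tu_t^\dagger$. Assume there is a set $\emptyset\ne\mathcal T'\subset\mathcal T$ such that: 1. for every $t\in\mathcal T'$ the snapshot $u_t^\dagger$ is reconstructible via $\mathrm{Ob}_t$. Here $\nu=\sum_{i=1}^n c_i\delta_{y_i}\in\mathcal M_+(\Omega)$ (distinct $y_i$, $c_i>0$) is called reconstructible if there are $\kappa,\mu,R>0$, with $R<|y_i-y_j|$ for all $i\ne j$, such that for every $s\in\{-1,1\}^n$ there are $w,w^s\in H$ with $-\mathrm{Ob}_t^*w\in\partial\|\cdot\|_{\mathcal M}(\nu)$, $-\mathrm{Ob}_t^*w^s\in\partial\|\cdot\|_{\mathcal M}(\sum_is_i\delta_{y_i})$, $-\mathrm{Ob}_t^*w(y)\le1-\kappa\min\{R,\mathrm{dist}(y,\{y_1,\dots,y_n\})\}^2$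 for all $y\in\Omega$, and $\mathrm{Ob}_t^*w^s(y_i)\,\mathrm{Ob}_t^*w^s(y)\ge1-\mu|y-y_i|^2$ for all $i$ and all $y\in\Omega$ with $|y-y_i|<R$; 2. (no coincidences) $x_i+tv_i\neq x_j+tv_j$ for all $t\in\mathcal T'$ and $i\ne j$; 3. (no ghost particles) there is no $(x,v)\in(\mathbb R^d\times\mathbb R^d)\setminus\operatorname{supp}\lambda^\dagger$ such that for each $t\in\mathcal T'$ there is an $i$ with $x+tv=x_i+tv_i$. Models ($\alpha=0$, data $f^\dagger$). Product model, for a fixed $\hat\theta\in\Theta$: minimize $\|\gamma_{\hat\theta}\|_{\mathcal M}$ over $\gamma\in\mathcal M_+(\Gamma)^\Theta$, $u\in\mathcal M_+(\Omega)^\Sigma$ subject to $M^1_t\gamma_\theta=R_\theta u_t$ for all $t\in\Sigma$, $\theta\in\Theta$, and $\mathrm{Ob}_tu_t=f_t^\dagger$ for all $t\in\mathcal T$. Mixed model: minimize $\|\gamma\|_{\mathcal M}$ over $\gamma\in\mathcal M_+(\Theta\times\Gamma)$, $u\in\mathcal M_+(\Omega)^\Sigma$ subject to: $\gamma$ has a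 disintegration $\gamma=\mathcal H_\Theta(\theta)\otimes\gamma_\theta$ such that for every $t\in\Sigma$, $M^1_t\gamma_\theta=R_\theta u_t$ for $\mathcal H_\Theta$-a.e. $\theta$; and $\mathrm{Ob}_tu_t=f_t^\dagger$ for all $t\in\mathcal T$. Theorem. Suppose that $\mathcal H_\Theta$ (extended by zero to $S^{d-1}$) has a nonzero lower semicontinuous density with respect to the $(d-1)$-dimensional Hausdorff measure on $S^{d-1}$. Then every solution $(u,\gamma)$ of the product model (for any $\hat\theta\in\Theta$) and every solution $(u,\gamma)$ of the mixed model satisfies $u_t=u_t^\dagger$ for all $t\in\Sigma$, and $\gamma_\theta=\gamma_\theta^\dagger$ for $\mathcal H_\Theta$-almost all $\theta\in\Theta$ (in the mixed model, for any disintegration $\gamma=\mathcal H_\Theta(\theta)\otimes\gamma_\theta$). -/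

import Mathlib

open MeasureTheory
open scoped NNReal ENNReal

namespace DimReduced

noncomputable section

/-! ### Measures: norm, pairing with continuous functions, subdifferential of the norm

`SignedMeasure X` is the space of real Borel measures `M(X)` and `FiniteMeasure X` its positive cone
`M₊(X)`. All spaces below are subsets of finite-dimensional spaces, and on the compact ones every
finite Borel measure is a Radon measure. -/

section Measures

variable {X Y : Type*} [MeasurableSpace X] [MeasurableSpace Y]

/-- The total variation norm `‖ν‖ = |ν|(X)` of a real measure. -/
def tvNorm (ν : SignedMeasure X) : ℝ := (ν.variation Set.univ).toReal

/-- A nonnegative finite measure regarded as a real measure. -/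
def toSigned (ν : FiniteMeasure X) : SignedMeasure X := (ν : Measure X).toSignedMeasure

/-- The Dirac measure `δ_x ∈ M₊(X)`. -/
def diracM (x : X) : FiniteMeasure X := ⟨Measure.dirac x, inferInstance⟩

variable [TopologicalSpace X]

/-- The duality pairing `⟨w, ν⟩ = ∫ w dν` of a continuous function and a real measure. -/
def pairing (w : C(X, ℝ)) (ν : SignedMeasure X) : ℝ := ∫ᵛ x, w x ∂<•ν

/-- The (predual) subdifferential of the total variation norm at `ν`: all continuous `w` with
`‖ν'‖ ≥ ‖ν‖ + ⟨w, ν' - ν⟩` for every real measure `ν'`. -/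
def normSubdifferential (ν : SignedMeasure X) : Set C(X, ℝ) :=
  {w | ∀ ν' : SignedMeasure X, tvNorm ν + pairing w (ν' - ν) ≤ tvNorm ν'}

end Measures

/-! ### Observation operators and reconstructible measures -/

section Observation

/-- A (weak-* to weak continuous) linear observation operator `Ob : M(X) → H`, that is, a linear
operator that is the dual of a bounded linear operator `Ob^* : H → C(X)`. -/
structure ObservationOperator (X H : Type*) [TopologicalSpace X] [MeasurableSpace X]
    [NormedAddCommGroup H] [InnerProductSpace ℝ H] where
  /-- the operator `Ob` -/
  toLin : SignedMeasure X →ₗ[ℝ] H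
  /-- the predual operator `Ob^*` -/
  predual : H →L[ℝ] C(X, ℝ)
  /-- `⟨h, Ob ν⟩_H = ∫ (Ob^* h) dν` -/
  duality : ∀ (h : H) (ν : SignedMeasure X), inner ℝ h (toLin ν) = pairing (predual h) ν

variable {X H : Type*} [MetricSpace X] [MeasurableSpace X]
  [NormedAddCommGroup H] [InnerProductSpace ℝ H]

/-- The observation of a nonnegative measure. -/
def ObservationOperator.observe (Ob : ObservationOperator X H) (ν : FiniteMeasure X) : H :=
  Ob.toLin (toSigned ν)

/-- `ν = ∑ i, m i • δ_{x i}` (distinct points, positive masses) is reconstructible from measurements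
via `Ob`: there are `κ, μ, R > 0`, with `R` smaller than the minimum point separation, such that for
every sign vector `s` there are dual variables `vd, vs` certifying `ν` and
`∑ i, s i • δ_{x i}`, respectively. -/
def Reconstructible (Ob : ObservationOperator X H) (ν : FiniteMeasure X) : Prop :=
  ∃ (N : ℕ) (m : Fin N → ℝ≥0) (x : Fin N → X),
    Function.Injective x ∧ (∀ i, 0 < m i) ∧ ν = ∑ i, m i • diracM (x i) ∧
    ∃ κ μ R : ℝ, 0 < κ ∧ 0 < μ ∧ 0 < R ∧ (∀ i j, i ≠ j → R < dist (x i) (x j)) ∧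
      ∀ s : Fin N → ℝ, (∀ i, s i = 1 ∨ s i = -1) →
        ∃ vd vs : H,
          -Ob.predual vd ∈ normSubdifferential (toSigned ν) ∧
          -Ob.predual vs ∈ normSubdifferential (∑ i, s i • toSigned (diracM (x i))) ∧
          (∀ y : X, -Ob.predual vd y
              ≤ 1 - κ * (min R (Metric.infDist y (Set.range x))) ^ 2) ∧
          (∀ i, ∀ y ∈ Metric.ball (x i) R,
            1 - μ * dist y (x i) ^ 2 ≤ Ob.predual vs (x i) * Ob.predual vs y)

end Observation

/-! ### Particle configurations -/

/-- Position space `ℝ^d`. -/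
abbrev Space (d : ℕ) : Type := EuclideanSpace ℝ (Fin d)

/-- The unit sphere `S^{d-1}` of directions. -/
abbrev Sphere (d : ℕ) : Type := Metric.sphere (0 : Space d) 1

/-- Finitely many points of `Y` with nonnegative masses. -/
structure ParticleConfig (Y : Type*) where
  /-- number of particles -/
  N : ℕ
  /-- masses -/
  mass : Fin N → ℝ≥0
  /-- points (for `Y ⊆ ℝ^d × ℝ^d`: initial positions and velocities) -/
  point : Fin N → Y

namespace ParticleConfig

/-- The measure `∑ i, m i • δ_{y i}` represented by a configuration. -/
def toMeasure {Y : Type*} [MeasurableSpace Y] (P : ParticleConfig Y) : FiniteMeasure Y :=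
  ∑ i, P.mass i • diracM (P.point i)

/-- The same configuration with its points viewed in another space. -/
def map {Y Z : Type*} (f : Y → Z) (P : ParticleConfig Y) : ParticleConfig Z :=
  ⟨P.N, P.mass, f ∘ P.point⟩

variable {d : ℕ} (P : ParticleConfig (Space d × Space d))

/-- The location `x_i + t v_i` of particle `i` at time `t`. -/
def location (t : ℝ) (i : Fin P.N) : Space d := (P.point i).1 + t • (P.point i).2

/-- Two distinct particles share their location at time `t`. -/
def HasCoincidence (t : ℝ) : Prop := ∃ i j, i ≠ j ∧ P.location t i = P.location t j

/-- There is a ghost particle with respect to the set of times `T'`: a pair `(x, v)` outside the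
support of the configuration whose location at each time in `T'` is the location of some particle. -/
def HasGhostParticle (T' : Set ℝ) : Prop :=
  ∃ p : Space d × Space d, p ∉ (P.toMeasure : Measure (Space d × Space d)).support ∧
    ∀ t ∈ T', ∃ i, p.1 + t • p.2 = P.location t i

end ParticleConfig

/-! ### Domains, Radon and move operators -/

section Model

variable {d : ℕ}

/-- `Λ`: position-velocity pairs of particles that stay in `Ω` at all times in `S`. -/
def Lam (Ω : Set (Space d)) (S : Set ℝ) : Set (Space d × Space d) :=
  {z | ∀ t ∈ S, z.1 + t • z.2 ∈ Ω}

/-- `Γ`: all projections `(θ · x, θ · v)` with `(x, v) ∈ Λ` and `θ ∈ Θ`. -/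
def Gam (Ω : Set (Space d)) (S : Set ℝ) (Θ : Set (Sphere d)) : Set (ℝ × ℝ) :=
  {q | ∃ z ∈ Lam Ω S, ∃ θ ∈ Θ, q = (inner ℝ (θ : Space d) z.1, inner ℝ (θ : Space d) z.2)}

variable {Ω : Set (Space d)} {S : Set ℝ} {Θ : Set (Sphere d)}

/-- The Radon transform `R_θ u`, the pushforward of `u` under `x ↦ θ · x`. -/
def radon (θ : Θ) (u : FiniteMeasure Ω) : FiniteMeasure ℝ :=
  u.map fun x => inner ℝ (θ.1 : Space d) (x : Space d)

/-- The joint Radon transform, the pushforward of `lam` under `(x, v) ↦ (θ · x, θ · v)`. -/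
def jointRadon (θ : Θ) (lam : FiniteMeasure (Lam Ω S)) : FiniteMeasure (Gam Ω S Θ) :=
  lam.map fun z => ⟨(inner ℝ (θ.1 : Space d) z.1.1, inner ℝ (θ.1 : Space d) z.1.2),
    ⟨z.1, z.2, θ.1, θ.2, rfl⟩⟩

/-- The `d`-dimensional move operator at time `t`, the pushforward under `(x, v) ↦ x + t v`. -/
def moveSpace (t : S) (lam : FiniteMeasure (Lam Ω S)) : FiniteMeasure Ω :=
  lam.map fun z => ⟨z.1.1 + (t : ℝ) • z.1.2, z.2 t t.2⟩

/-- The one-dimensional move operator at time `t`, the pushforward under `(y, w) ↦ y + t w`. -/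
def moveLine (t : ℝ) (g : FiniteMeasure (Gam Ω S Θ)) : FiniteMeasure ℝ :=
  g.map fun q => q.1.1 + t * q.1.2

/-- `γ = H ⊗_θ γ_θ`: the measure `γ` on `Θ × Y` has the slices `κ θ = γ_θ` with respect to `H`. -/
def IsDisintegration {Y : Type*} [MeasurableSpace Y] (H : Measure Θ)
    (γ : FiniteMeasure (Θ × Y)) (κ : Θ → FiniteMeasure Y) : Prop :=
  (∀ B : Set Y, MeasurableSet B → AEMeasurable (fun θ => (κ θ : Measure Y) B) H) ∧
  ∀ (A : Set Θ) (B : Set Y), MeasurableSet A → MeasurableSet B →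
    (γ : Measure (Θ × Y)) (A ×ˢ B) = ∫⁻ θ in A, (κ θ : Measure Y) B ∂H

/-- `H`, extended by zero to the sphere, has a nonzero lower semicontinuous density with respect to
the `(d-1)`-dimensional Hausdorff measure on the sphere `S^{d-1}`. -/
def HasLowerSemicontinuousDensity (H : Measure Θ) : Prop :=
  ∃ ρ : Sphere d → ℝ≥0∞, LowerSemicontinuous ρ ∧ ρ ≠ 0 ∧
    H.map (Subtype.val : Θ → Sphere d) =
      (Measure.hausdorffMeasure ((d : ℝ) - 1) : Measure (Sphere d)).withDensity ρ

/-! ### The two dimension-reduced models with hard data constraint (`α = 0`) -/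

variable {H : Type*} [NormedAddCommGroup H] [InnerProductSpace ℝ H]

/-- Feasible pairs of the product-topology model: snapshots `u_t` for `t ∈ S`, projections `γ_θ` for
all `θ ∈ Θ`. -/
def FeasibleProduct (T : Set ℝ) (Ob : S → ObservationOperator Ω H) (f : S → H)
    (u : S → FiniteMeasure Ω) (γ : Θ → FiniteMeasure (Gam Ω S Θ)) : Prop :=
  (∀ (t : S) (θ : Θ), moveLine t (γ θ) = radon θ (u t)) ∧
  ∀ t : S, (t : ℝ) ∈ T → (Ob t).observe (u t) = f t

/-- `(u, γ)` minimises `‖γ_{θ₀}‖` among all feasible pairs of the product-topology model. -/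
def SolvesProduct (θ₀ : Θ) (T : Set ℝ) (Ob : S → ObservationOperator Ω H) (f : S → H)
    (u : S → FiniteMeasure Ω) (γ : Θ → FiniteMeasure (Gam Ω S Θ)) : Prop :=
  FeasibleProduct T Ob f u γ ∧
  ∀ u' γ', FeasibleProduct T Ob f u' γ' → (γ θ₀).mass ≤ (γ' θ₀).mass

/-- Feasible pairs of the mixed model: snapshots `u_t` for `t ∈ S`, and a measure `γ` on `Θ × Γ`
which has slices `γ_θ` with respect to `HΘ`, compatible with the snapshots for almost all `θ`. -/
def FeasibleMixed (HΘ : Measure Θ) (T : Set ℝ) (Ob : S → ObservationOperator Ω H) (f : S → H)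
    (u : S → FiniteMeasure Ω) (γ : FiniteMeasure (Θ × Gam Ω S Θ)) : Prop :=
  (∃ κ : Θ → FiniteMeasure (Gam Ω S Θ), IsDisintegration HΘ γ κ ∧
    ∀ t : S, ∀ᵐ θ ∂HΘ, moveLine t (κ θ) = radon θ (u t)) ∧
  ∀ t : S, (t : ℝ) ∈ T → (Ob t).observe (u t) = f t

/-- `(u, γ)` minimises `‖γ‖` among all feasible pairs of the mixed model. -/
def SolvesMixed (HΘ : Measure Θ) (T : Set ℝ) (Ob : S → ObservationOperator Ω H) (f : S → H)
    (u : S → FiniteMeasure Ω) (γ : FiniteMeasure (Θ × Gam Ω S Θ)) : Prop :=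
  FeasibleMixed HΘ T Ob f u γ ∧
  ∀ u' γ', FeasibleMixed HΘ T Ob f u' γ' → γ.mass ≤ γ'.mass

/-! ### Ground truth -/

variable (lam : ParticleConfig (Lam Ω S))

/-- The ground truth snapshot `u_t†`. -/
def trueSnapshot (t : S) : FiniteMeasure Ω := moveSpace t lam.toMeasure

/-- The ground truth position-velocity projection `γ_θ†`. -/
def trueProjection (θ : Θ) : FiniteMeasure (Gam Ω S Θ) := jointRadon θ lam.toMeasure

/-- The noise-free data `f_t†`. -/
def trueData (Ob : S → ObservationOperator Ω H) (t : S) : H := (Ob t).observe (trueSnapshot lam t)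

/-- Ground truth regularity: there is a nonempty set `T' ⊆ T` of times at which the snapshots are
reconstructible, such that the configuration has neither coincidences in `T'` nor ghost particles
with respect to `T'`. -/
def GroundTruthRegular (T : Set ℝ) (Ob : S → ObservationOperator Ω H) : Prop :=
  ∃ T' ⊆ T, T'.Nonempty ∧
    (∀ t : S, (t : ℝ) ∈ T' → Reconstructible (Ob t) (trueSnapshot lam t)) ∧
    (∀ t ∈ T', ¬ (lam.map Subtype.val).HasCoincidence t) ∧
    ¬ (lam.map Subtype.val).HasGhostParticle T'

end Model

end

end DimReduced

open DimReduced

/-! Pushforwards preserve mass, so compatibility makes every snapshot as heavy as its projections.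
The ground truth is feasible, and comparing a minimizer with it bounds the mass of every `u t` by
the total true mass.

At a time in `T'` this bound and the data determine the snapshot
(`DimReduced.Reconstructible.eq_of_observe_eq`). One dual certificate forces `u t` onto the true
points, and the certificate for the signs of the mass errors forces those errors to vanish.

A direction can create coincidences or ghosts under projection only if it is orthogonal to one of
countably many nonzero vectors (`exists_countable_forall_projection`). Such directions are null
because `HΘ` has a density. In every other compatible direction, the moves at times in `T'` carry
`γ_θ` onto the projected particles and fix their masses (`eq_trueProjection_of_moveLine_eq`).

At any further time, moving the recovered `γ_θ` gives the Radon transform of `u t` for almost every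
direction. Lower semicontinuity makes the set where the density is positive open, and the good
directions are dense in it. Moments of a compactly supported measure are polynomial in the
direction, so an open set of directions determines them all, hence the characteristic function and
the measure (`measure_eq_of_forall_map_inner_eq`). -/

/-! ### Finitely supported atomic measures -/

section Atomic

variable {X Y : Type*} [MeasurableSpace X] [MeasurableSpace Y]

theorem MeasureTheory.Measure.eq_of_forall_singleton_of_ae_mem [MeasurableSingletonClass X]
    {μ ν : Measure X} {F : Set X} (hF : F.Countable) (hμ : ∀ᵐ x ∂μ, x ∈ F) (hν : ∀ᵐ x ∂ν, x ∈ F)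
    (h : ∀ x ∈ F, μ {x} = ν {x}) : μ = ν := by
  rw [← Measure.restrict_eq_self_of_ae_mem hμ, ← Measure.restrict_eq_self_of_ae_mem hν]
  ext B hB
  rw [Measure.restrict_apply hB, Measure.restrict_apply hB]
  have hc : (B ∩ F).Countable := hF.mono Set.inter_subset_right
  rw [← Set.biUnion_of_singleton (B ∩ F),
    measure_biUnion hc (fun x _ y _ hxy => Set.disjoint_singleton.2 hxy)
      fun x _ => measurableSet_singleton x,
    measure_biUnion hc (fun x _ y _ hxy => Set.disjoint_singleton.2 hxy)
      fun x _ => measurableSet_singleton x]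
  exact tsum_congr fun x => h x x.2.2

theorem toMeasure_sum_smul_diracM {ι : Type*} [Fintype ι] (m : ι → ℝ≥0) (x : ι → X) :
    ((∑ i, m i • diracM (x i) : FiniteMeasure X) : Measure X)
      = ∑ i, m i • Measure.dirac (x i) := by
  rw [FiniteMeasure.toMeasure_sum]
  rfl

theorem sum_smul_dirac_apply {ι : Type*} [Fintype ι] (m : ι → ℝ≥0) (x : ι → X) {B : Set X}
    (hB : MeasurableSet B) :
    ((∑ i, m i • diracM (x i) : FiniteMeasure X) : Measure X) B
      = ∑ i, (m i : ℝ≥0∞) * B.indicator 1 (x i) := by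
  rw [toMeasure_sum_smul_diracM, Measure.finsetSum_apply]
  refine Finset.sum_congr rfl fun i _ => ?_
  rw [← Measure.dirac_apply' _ hB]
  rfl

theorem sum_smul_diracM_singleton [MeasurableSingletonClass X] {ι : Type*} [Fintype ι]
    (m : ι → ℝ≥0) {x : ι → X} (hx : Function.Injective x) (i : ι) :
    ((∑ i, m i • diracM (x i) : FiniteMeasure X) : Measure X) {x i} = m i := by
  classical
  rw [sum_smul_dirac_apply _ _ (measurableSet_singleton _), Finset.sum_eq_single i]
  · simp
  · intro j _ hj
    simp [hx.eq_iff, hj]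
  · simp

theorem ae_sum_smul_diracM [MeasurableSingletonClass X] {ι : Type*} [Fintype ι]
    (m : ι → ℝ≥0) (x : ι → X) :
    ∀ᵐ y ∂((∑ i, m i • diracM (x i) : FiniteMeasure X) : Measure X), y ∈ Set.range x := by
  have hfin : (Set.range x).Finite := Set.finite_range x
  rw [ae_iff]
  change (_ : Measure X) ((Set.range x)ᶜ) = 0
  rw [sum_smul_dirac_apply _ _ hfin.measurableSet.compl]
  simp

theorem mass_sum_smul_diracM {ι : Type*} [Fintype ι] (m : ι → ℝ≥0) (x : ι → X) :
    (∑ i, m i • diracM (x i) : FiniteMeasure X).mass = ∑ i, m i := by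
  have := sum_smul_dirac_apply m x MeasurableSet.univ
  rw [← FiniteMeasure.ennreal_mass] at this
  simp only [Set.indicator_univ, Pi.one_apply, mul_one] at this
  exact_mod_cast this

theorem map_sum_smul_diracM {ι : Type*} [Fintype ι] (m : ι → ℝ≥0) (x : ι → X) {f : X → Y}
    (hf : Measurable f) :
    (∑ i, m i • diracM (x i) : FiniteMeasure X).map f = ∑ i, m i • diracM (f (x i)) := by
  apply FiniteMeasure.toMeasure_injective
  ext B hB
  rw [FiniteMeasure.toMeasure_map, Measure.map_apply hf hB, sum_smul_dirac_apply _ _ (hf hB),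
    sum_smul_dirac_apply _ _ hB]
  rfl

theorem eq_sum_smul_diracM [MeasurableSingletonClass X] {ι : Type*} [Fintype ι]
    {m : ι → ℝ≥0} {x : ι → X} (hx : Function.Injective x) {μ : FiniteMeasure X}
    (hμ : ∀ᵐ y ∂(μ : Measure X), y ∈ Set.range x) (hm : ∀ i, (μ : Measure X) {x i} = m i) :
    μ = ∑ i, m i • diracM (x i) := by
  apply FiniteMeasure.toMeasure_injective
  refine Measure.eq_of_forall_singleton_of_ae_mem (Set.countable_range x) hμ
    (ae_sum_smul_diracM m x) ?_
  rintro _ ⟨i, rfl⟩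
  rw [hm, sum_smul_diracM_singleton m hx]

end Atomic

/-! ### Dual certificates and recovery of single snapshots -/

section DualCertificate

variable {X : Type*} [MeasurableSpace X]

theorem tvNorm_zero : tvNorm (0 : SignedMeasure X) = 0 := by
  simp [tvNorm]

theorem tvNorm_smul (c : ℝ) (ν : SignedMeasure X) : tvNorm (c • ν) = |c| * tvNorm ν := by
  rw [tvNorm, tvNorm, VectorMeasure.variation_smul]
  simp

theorem tvNorm_toSigned (u : FiniteMeasure X) : tvNorm (toSigned u) = u.mass := by
  rw [tvNorm, toSigned, Measure.variation_toSignedMeasure, ← FiniteMeasure.ennreal_mass,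
    ENNReal.coe_toReal]

theorem toSigned_apply (u : FiniteMeasure X) {B : Set X} (hB : MeasurableSet B) :
    toSigned u B = ((u : Measure X) B).toReal := by
  rw [toSigned, Measure.toSignedMeasure_apply_measurable hB]
  rfl

theorem toSigned_sum_smul_diracM {ι : Type*} [Fintype ι] (m : ι → ℝ≥0) (x : ι → X) :
    toSigned (∑ i, m i • diracM (x i)) = ∑ i, (m i : ℝ) • toSigned (diracM (x i)) := by
  ext B hB
  rw [toSigned_apply _ hB, toMeasure_sum_smul_diracM, Measure.finsetSum_apply,
    ENNReal.toReal_sum (fun i _ => measure_ne_top _ _)]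
  rw [FunLike.coe_sum, Finset.sum_apply]
  simp only [_root_.smul_apply]
  refine Finset.sum_congr rfl fun i _ => ?_
  rw [toSigned_apply _ hB]
  simp [diracM]

/-- Distinct points are disjoint singletons, and each contributes variation at least `|s i| = 1`. -/
theorem card_le_tvNorm_sum_sign_smul_dirac [MeasurableSingletonClass X] {N : ℕ} {x : Fin N → X}
    (hx : Function.Injective x) {s : Fin N → ℝ} (hs : ∀ i, s i = 1 ∨ s i = -1) :
    (N : ℝ) ≤ tvNorm (∑ i, s i • toSigned (diracM (x i))) := by
  set σ : SignedMeasure X := ∑ i, s i • toSigned (diracM (x i)) with hσ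
  have hval : ∀ i, σ {x i} = s i := by
    intro i
    rw [hσ]
    rw [FunLike.coe_sum, Finset.sum_apply]
    simp only [_root_.smul_apply]
    rw [Finset.sum_eq_single i]
    · rw [toSigned_apply _ (measurableSet_singleton _)]
      simp [diracM]
    · intro j _ hj
      rw [toSigned_apply _ (measurableSet_singleton _)]
      simp [diracM, hx.eq_iff, hj]
    · simp
  have hfin : σ.variation Set.univ ≠ ⊤ := by
    rw [← SignedMeasure.totalVariation_eq_variation]
    exact measure_ne_top _ _
  have h1 : ∑ i, σ.variation {x i} ≤ σ.variation Set.univ := by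
    refine sum_measure_le_measure_univ (fun i _ => (measurableSet_singleton _).nullMeasurableSet) ?_
    intro i _ j _ hij
    exact (Set.disjoint_singleton.2 (hx.ne hij)).aedisjoint
  have h2 : (N : ℝ≥0∞) ≤ σ.variation Set.univ := by
    refine le_trans ?_ h1
    calc (N : ℝ≥0∞) = ∑ i : Fin N, (1 : ℝ≥0∞) := by simp
      _ ≤ _ := Finset.sum_le_sum fun i _ => by
        refine le_trans ?_ (VectorMeasure.enorm_measure_le_variation σ {x i})
        rw [hval]
        rcases hs i with h | h <;> simp [h]
  have := ENNReal.toReal_mono hfin h2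
  simpa [tvNorm] using this

variable {H : Type*} [NormedAddCommGroup H] [InnerProductSpace ℝ H]

theorem pairing_toSigned [TopologicalSpace X] (w : C(X, ℝ)) (u : FiniteMeasure X) :
    pairing w (toSigned u) = ∫ x, w x ∂(u : Measure X) := by
  simp [pairing, toSigned]

variable [MetricSpace X]

theorem pairing_neg_predual (Ob : ObservationOperator X H) (h : H) (ν : SignedMeasure X) :
    pairing (-Ob.predual h) ν = inner ℝ (-h) (Ob.toLin ν) := by
  rw [Ob.duality, map_neg]

/-- The norm is positively homogeneous, so testing the subgradient inequality at `0` and at `2 • ν`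
gives the two opposite bounds. -/
theorem normSubdifferential_pairing_self {Ob : ObservationOperator X H} {h : H}
    {ν : SignedMeasure X} (hv : -Ob.predual h ∈ normSubdifferential ν) :
    inner ℝ (-h) (Ob.toLin ν) = tvNorm ν := by
  have h0 := hv 0
  have h2 := hv ((2 : ℝ) • ν)
  rw [pairing_neg_predual] at h0 h2
  rw [tvNorm_smul] at h2
  rw [tvNorm_zero] at h0
  simp only [map_sub, map_zero, map_smul, inner_sub_right, inner_smul_right,
    inner_zero_right] at h0 h2
  rw [abs_of_pos two_pos] at h2
  linarith

/-- A subgradient attains the norm at `ν`; cancelling that term leaves a dual bound for every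
measure. -/
theorem normSubdifferential_pairing_le {Ob : ObservationOperator X H} {h : H}
    {ν : SignedMeasure X} (hv : -Ob.predual h ∈ normSubdifferential ν) (ν' : SignedMeasure X) :
    inner ℝ (-h) (Ob.toLin ν') ≤ tvNorm ν' := by
  have h0 := hv ν'
  rw [pairing_neg_predual, map_sub, inner_sub_right, normSubdifferential_pairing_self hv] at h0
  linarith

/-- A reconstructible measure is the unique nonnegative measure with its observation among those of
no larger mass. -/
theorem DimReduced.Reconstructible.eq_of_observe_eq [BorelSpace X] [CompactSpace X]
    {Ob : ObservationOperator X H}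
    {ν u : FiniteMeasure X} (hν : Reconstructible Ob ν) (hmass : u.mass ≤ ν.mass)
    (hobs : Ob.observe u = Ob.observe ν) : u = ν := by
  obtain ⟨N, m, x, hx, -, rfl, κ, μ, R, hκ, -, hR, -, hs⟩ := hν
  -- With no points, `Metric.infDist` takes its default value `0` and the decay bound is empty; the
  -- mass bound alone gives `u = 0`.
  rcases Nat.eq_zero_or_pos N with rfl | hN
  · simp only [Finset.univ_eq_empty, Finset.sum_empty, FiniteMeasure.zero_mass,
      nonpos_iff_eq_zero, FiniteMeasure.mass_zero_iff] at hmass ⊢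
    exact hmass
  have : Nonempty (Fin N) := ⟨⟨0, hN⟩⟩
  let c : Fin N → ℝ≥0 := fun i => ((u : Measure X) {x i}).toNNReal
  -- The signs of the mass errors `c i - m i`: pairing `-vs` with `u - ν` will then give the sum of
  -- their absolute values.
  let s : Fin N → ℝ := fun i => if m i ≤ c i then 1 else -1
  have hs1 : ∀ i, s i = 1 ∨ s i = -1 := fun i => by
    by_cases h : m i ≤ c i <;> simp [s, h]
  obtain ⟨vd, vs, hvd, hvs, hdec, -⟩ := hs s hs1
  have hobs' : Ob.toLin (toSigned u) = Ob.toLin (toSigned (∑ i, m i • diracM (x i))) := hobs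
  -- concentration on the points `x i`
  have hconc : ∀ᵐ y ∂(u : Measure X), y ∈ Set.range x := by
    set w : C(X, ℝ) := -Ob.predual vd with hw
    have hint : ∀ g : C(X, ℝ), Integrable g (u : Measure X) := fun g =>
      g.continuous.integrable_of_hasCompactSupport
        (HasCompactSupport.of_compactSpace _)
    have hle : ∀ y, w y ≤ 1 - κ * (min R (Metric.infDist y (Set.range x))) ^ 2 := hdec
    have hnonneg : ∀ y, 0 ≤ 1 - w y := fun y => by
      have := hle y
      have : 0 ≤ κ * (min R (Metric.infDist y (Set.range x))) ^ 2 := by positivity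
      linarith
    -- The integral of `w` depends on `u` only through its observation, so it equals the mass of the
    -- true measure. As `w ≤ 1` and `u` is no heavier, `w = 1` almost everywhere, which the
    -- quadratic decay allows only at the points `x i`.
    have hP : ∫ y, w y ∂(u : Measure X) = (∑ i, m i • diracM (x i) : FiniteMeasure X).mass := by
      rw [← pairing_toSigned, hw, pairing_neg_predual, hobs',
        normSubdifferential_pairing_self hvd, tvNorm_toSigned]
    have hzero : ∫ y, (1 - w y) ∂(u : Measure X) = 0 := by
      apply le_antisymm _ (integral_nonneg hnonneg)
      rw [integral_sub (integrable_const _) (hint w), hP, integral_const]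
      have : (u : Measure X).real Set.univ = u.mass := by
        rw [FiniteMeasure.measureReal_eq_coe_coeFn]
        rfl
      rw [this, smul_eq_mul, mul_one, sub_nonpos]
      exact_mod_cast hmass
    have hae := (integral_eq_zero_iff_of_nonneg hnonneg
      ((integrable_const _).sub (hint w))).1 hzero
    filter_upwards [hae] with y hy
    have hy' : 1 - w y = 0 := hy
    have h1 : κ * (min R (Metric.infDist y (Set.range x))) ^ 2 ≤ 0 := by
      have := hle y
      linarith
    have h2 : min R (Metric.infDist y (Set.range x)) = 0 := by
      by_contra hne
      have : 0 < κ * (min R (Metric.infDist y (Set.range x))) ^ 2 := by positivity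
      linarith
    have h3 : Metric.infDist y (Set.range x) = 0 := by
      rcases min_choice R (Metric.infDist y (Set.range x)) with h | h
      · rw [h] at h2
        exact absurd h2 hR.ne'
      · rwa [h] at h2
    exact ((Set.finite_range x).isClosed.mem_iff_infDist_zero (Set.range_nonempty x)).2 h3
  have hu : u = ∑ i, c i • diracM (x i) := by
    refine eq_sum_smul_diracM hx hconc fun i => ?_
    rw [ENNReal.coe_toNNReal (measure_ne_top _ _)]
  -- agreement of the masses
  have hsw : ∀ i, s i * inner ℝ (-vs) (Ob.toLin (toSigned (diracM (x i)))) = 1 := by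
    have hle1 : ∀ i, s i * inner ℝ (-vs) (Ob.toLin (toSigned (diracM (x i)))) ≤ 1 := by
      intro i
      have := normSubdifferential_pairing_le hvs (s i • toSigned (diracM (x i)))
      rw [tvNorm_smul, tvNorm_toSigned, map_smul, inner_smul_right] at this
      refine this.trans ?_
      have h1 : (diracM (x i)).mass = 1 := by
        simp [diracM, FiniteMeasure.mass]
      rcases hs1 i with h | h <;> simp [h, h1]
    -- The `N` terms are each at most `1` and sum to at least `N`, so each equals `1`.
    have hsum : (N : ℝ) ≤ ∑ i, s i * inner ℝ (-vs) (Ob.toLin (toSigned (diracM (x i)))) := by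
      refine (card_le_tvNorm_sum_sign_smul_dirac hx hs1).trans ?_
      rw [← normSubdifferential_pairing_self hvs, map_sum, inner_sum]
      simp only [map_smul, inner_smul_right]
      exact le_rfl
    have heq : ∑ i, s i * inner ℝ (-vs) (Ob.toLin (toSigned (diracM (x i)))) = ∑ i : Fin N, 1 := by
      apply le_antisymm (Finset.sum_le_sum fun i _ => hle1 i)
      simpa using hsum
    intro i
    exact (Finset.sum_eq_sum_iff_of_le fun i _ => hle1 i).1 heq i (Finset.mem_univ i)
  have hdiff : ∑ i, |(c i : ℝ) - m i| = 0 := by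
    have h := congrArg (inner ℝ (-vs)) hobs'
    rw [hu, toSigned_sum_smul_diracM, toSigned_sum_smul_diracM, map_sum, map_sum, inner_sum,
      inner_sum] at h
    simp only [map_smul, inner_smul_right] at h
    rw [← sub_eq_zero, ← Finset.sum_sub_distrib] at h
    rw [← h]
    refine Finset.sum_congr rfl fun i _ => ?_
    have h1 := hsw i
    by_cases hi : m i ≤ c i
    · have hsi : s i = 1 := if_pos hi
      rw [hsi, one_mul] at h1
      rw [h1, abs_of_nonneg (sub_nonneg.2 (NNReal.coe_le_coe.2 hi))]
      ring
    · have hsi : s i = -1 := if_neg hi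
      rw [hsi] at h1
      have h1' : inner ℝ (-vs) (Ob.toLin (toSigned (diracM (x i)))) = -1 := by linarith
      rw [h1', abs_of_neg (sub_neg.2 (NNReal.coe_lt_coe.2 (not_le.1 hi)))]
      ring
  rw [hu]
  refine Finset.sum_congr rfl fun i _ => ?_
  have := (Finset.sum_eq_zero_iff_of_nonneg fun i _ => abs_nonneg _).1 hdiff i (Finset.mem_univ i)
  rw [abs_eq_zero, sub_eq_zero, NNReal.coe_inj] at this
  rw [this]

end DualCertificate

/-! ### Surface measure of the unit sphere -/

section SphereMeasure

variable {E : Type*} [NormedAddCommGroup E] [InnerProductSpace ℝ E] [FiniteDimensional ℝ E]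
  [MeasurableSpace E] [BorelSpace E]

open Module in
/-- Great subspheres are null sets for the surface measure of the unit sphere. -/
theorem hausdorffMeasure_sphere_inter_orthogonal {z : E} (hz : z ≠ 0) :
    (Measure.hausdorffMeasure ((finrank ℝ E : ℝ) - 1) : Measure (Metric.sphere (0 : E) 1))
      {θ | inner ℝ (θ : E) z = 0} = 0 := by
  set K : Submodule ℝ E := (ℝ ∙ z)ᗮ with hK
  have hfr : (finrank ℝ E : ℝ) - 1 = finrank ℝ K := by
    have h := (ℝ ∙ z).finrank_add_finrank_orthogonal
    rw [finrank_span_singleton hz] at h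
    rw [← h]
    push_cast
    ring
  rw [hfr, ← isometry_subtype_coe.hausdorffMeasure_image (Or.inl (Nat.cast_nonneg _))]
  have hsub : (Subtype.val '' {θ : Metric.sphere (0 : E) 1 | inner ℝ (θ : E) z = 0})
      ⊆ (Subtype.val : K → E) '' Metric.sphere (0 : K) 1 := by
    rintro _ ⟨θ, hθ, rfl⟩
    refine ⟨⟨θ, ?_⟩, ?_, rfl⟩
    · rw [hK, Submodule.mem_orthogonal_singleton_iff_inner_left]
      exact hθ
    · simp
  refine measure_mono_null hsub ?_
  rw [isometry_subtype_coe.hausdorffMeasure_image (Or.inl (Nat.cast_nonneg _))]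
  -- In its own dimension the Hausdorff measure of `K` is a Haar measure. If `K` is trivial, the
  -- sphere is empty because its radius is nonzero.
  exact Measure.addHaar_sphere_of_ne_zero _ _ one_ne_zero

open Module in
/-- The surface measure of the unit sphere charges nonempty open sets. -/
theorem hausdorffMeasure_sphere_pos_of_isOpen {V : Set (Metric.sphere (0 : E) 1)} (hV : IsOpen V)
    (hne : V.Nonempty) :
    (Measure.hausdorffMeasure ((finrank ℝ E : ℝ) - 1) : Measure (Metric.sphere (0 : E) 1)) V
      ≠ 0 := by
  obtain ⟨θ, hθ⟩ := hne
  have hθn : ‖(θ : E)‖ = 1 := by simp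
  have hθ0 : (θ : E) ≠ 0 := by
    intro h
    simp [h] at hθn
  set K : Submodule ℝ E := (ℝ ∙ (θ : E))ᗮ with hK
  have hfr : (finrank ℝ E : ℝ) - 1 = finrank ℝ K := by
    have h := (ℝ ∙ (θ : E)).finrank_add_finrank_orthogonal
    rw [finrank_span_singleton hθ0] at h
    rw [← h]
    push_cast
    ring
  rw [hfr, ← isometry_subtype_coe.hausdorffMeasure_image (Or.inl (Nat.cast_nonneg _))]
  -- Orthogonal projection does not increase Hausdorff measure, so it suffices that the shadow of
  -- `V` on the tangent hyperplane `K` contains a neighbourhood of `0`. The graph `y ↦ y + √(1 - ‖y‖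
  -- ^ 2) • θ` inverts the projection near `θ`.
  have hproj := hausdorffMeasure_orthogonalProjectionOnto_le (𝕜 := ℝ) K (finrank ℝ K)
    (Subtype.val '' V) (Nat.cast_nonneg _)
  have horth : ∀ y : K, inner ℝ (y : E) (θ : E) = 0 := fun y =>
    (Submodule.mem_orthogonal_singleton_iff_inner_left).1 y.2
  have hnorm : ∀ y : K, ‖y‖ ≤ 1 → ‖(y : E) + √(1 - ‖y‖ ^ 2) • (θ : E)‖ = 1 := by
    intro y hy
    have h1 : ‖(y : E) + √(1 - ‖y‖ ^ 2) • (θ : E)‖ ^ 2 = 1 := by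
      rw [norm_add_sq_real, inner_smul_right, horth, norm_smul, hθn, mul_one, Real.norm_eq_abs,
        sq_abs, Real.sq_sqrt (by nlinarith [norm_nonneg y])]
      simp
    nlinarith [norm_nonneg ((y : E) + √(1 - ‖y‖ ^ 2) • (θ : E))]
  obtain ⟨W, hW, rfl⟩ := isOpen_induced_iff.1 hV
  have hcont : Continuous fun y : K => (y : E) + √(1 - ‖y‖ ^ 2) • (θ : E) := by fun_prop
  have hnhds : (fun y : K => (y : E) + √(1 - ‖y‖ ^ 2) • (θ : E)) ⁻¹' W ∩ Metric.ball 0 1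
      ∈ nhds (0 : K) := by
    refine Filter.inter_mem (hcont.continuousAt.preimage_mem_nhds (hW.mem_nhds ?_))
      (Metric.ball_mem_nhds _ one_pos)
    simpa using hθ
  have hsub : (fun y : K => (y : E) + √(1 - ‖y‖ ^ 2) • (θ : E)) ⁻¹' W ∩ Metric.ball 0 1
      ⊆ K.orthogonalProjectionOnto '' (Subtype.val '' (Subtype.val ⁻¹' W :
        Set (Metric.sphere (0 : E) 1))) := by
    rintro y ⟨hyW, hy⟩
    have hy1 : ‖y‖ ≤ 1 := by simpa using (Metric.mem_ball.1 hy).le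
    refine ⟨_, ⟨⟨(y : E) + √(1 - ‖y‖ ^ 2) • (θ : E), ?_⟩, hyW, rfl⟩, ?_⟩
    · simpa using hnorm y hy1
    · have hθK : (θ : E) ∈ Kᗮ := by
        rw [hK]
        exact Submodule.le_orthogonal_orthogonal _ (Submodule.mem_span_singleton_self _)
      have : K.orthogonalProjectionOnto (θ : E) = 0 :=
        Submodule.orthogonalProjectionOnto_eq_zero_iff.2 hθK
      simp [this]
  intro h0
  rw [h0] at hproj
  have hz := measure_mono_null hsub (le_antisymm hproj bot_le)
  exact (Measure.measure_pos_of_mem_nhds _ hnhds).ne' hz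

end SphereMeasure

/-! ### Moments and the limited-angle Radon transform -/

section Moments

variable {E : Type*} [NormedAddCommGroup E] [InnerProductSpace ℝ E] [MeasurableSpace E]
  {Ω : Set E}

open Polynomial in
/-- The polynomial `s ↦ ∫ ⟨η₀ + s η, x⟩ ^ k dμ(x)`. -/
noncomputable def momentPolynomial (μ : Measure Ω) (η₀ η : E) (k : ℕ) : ℝ[X] :=
  ∑ m ∈ Finset.range (k + 1),
    C (∫ x : Ω, inner ℝ η (x : E) ^ m * inner ℝ η₀ (x : E) ^ (k - m) * (k.choose m : ℝ) ∂μ)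
      * X ^ m

/-- The top coefficient does not see the base point `η₀`, which lets information near `η₀` reach an
arbitrary direction. -/
theorem coeff_momentPolynomial_self (μ : Measure Ω) (η₀ η : E) (k : ℕ) :
    (momentPolynomial μ η₀ η k).coeff k = ∫ x : Ω, (inner ℝ η (x : E)) ^ k ∂μ := by
  rw [momentPolynomial, Polynomial.finsetSum_coeff, Finset.sum_eq_single k]
  · simp
  · intro m _ hm
    rw [Polynomial.coeff_C_mul, Polynomial.coeff_X_pow, if_neg hm.symm, mul_zero]
  · simp

variable [BorelSpace E] [CompactSpace Ω]

theorem integrable_of_continuous_compactSpace {X F : Type*} [TopologicalSpace X] [CompactSpace X]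
    [MeasurableSpace X] [OpensMeasurableSpace X] [NormedAddCommGroup F]
    [SecondCountableTopologyEither X F]
    (μ : Measure X) [IsFiniteMeasure μ] {g : X → F} (hg : Continuous g) : Integrable g μ := by
  obtain ⟨C, hC⟩ := isCompact_univ.exists_bound_of_continuousOn hg.continuousOn
  exact Integrable.of_bound hg.aestronglyMeasurable C
    (Filter.Eventually.of_forall fun x => hC x (Set.mem_univ x))

theorem continuous_integral_inner_pow (μ : Measure Ω) [IsFiniteMeasure μ] (k : ℕ) :
    Continuous fun η : E => ∫ x : Ω, (inner ℝ η (x : E)) ^ k ∂μ := by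
  obtain ⟨C, hC⟩ := isCompact_univ.exists_bound_of_continuousOn
    (continuous_subtype_val (p := (· ∈ Ω))).continuousOn
  rw [continuous_iff_continuousAt]
  intro η₀
  refine continuousAt_of_dominated (bound := fun _ => ((‖η₀‖ + 1) * C) ^ k) ?_ ?_ ?_ ?_
  · exact Filter.Eventually.of_forall fun η =>
      (by fun_prop : Continuous fun x : Ω => (inner ℝ η (x : E)) ^ k).aestronglyMeasurable
  · filter_upwards [Metric.ball_mem_nhds η₀ one_pos] with η hη
    refine Filter.Eventually.of_forall fun x => ?_
    rw [norm_pow]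
    have h1 : ‖η‖ ≤ ‖η₀‖ + 1 := by
      have h2 := norm_le_norm_add_norm_sub' η η₀
      have h3 := (mem_ball_iff_norm.1 hη).le
      linarith
    have h2 := hC x (Set.mem_univ x)
    gcongr
    calc ‖inner ℝ η (x : E)‖ ≤ ‖η‖ * ‖(x : E)‖ := norm_inner_le_norm _ _
      _ ≤ _ := by gcongr
  · exact integrable_const _
  · exact Filter.Eventually.of_forall fun x => by fun_prop

theorem eval_momentPolynomial (μ : Measure Ω) [IsFiniteMeasure μ] (η₀ η : E) (k : ℕ) (s : ℝ) :
    (momentPolynomial μ η₀ η k).eval s = ∫ x : Ω, (inner ℝ (η₀ + s • η) (x : E)) ^ k ∂μ := by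
  have h : ∀ x : Ω, (inner ℝ (η₀ + s • η) (x : E)) ^ k = ∑ m ∈ Finset.range (k + 1),
      (inner ℝ η (x : E) ^ m * inner ℝ η₀ (x : E) ^ (k - m) * (k.choose m : ℝ)) * s ^ m := by
    intro x
    rw [add_comm, inner_add_left, inner_smul_left, add_pow]
    refine Finset.sum_congr rfl fun m _ => ?_
    simp only [conj_trivial]
    ring
  simp_rw [h]
  rw [integral_finsetSum _ fun m _ => integrable_of_continuous_compactSpace μ (by fun_prop),
    momentPolynomial, Polynomial.eval_finsetSum]
  refine Finset.sum_congr rfl fun m _ => ?_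
  rw [integral_mul_const, integral_mul_const, integral_mul_const, Polynomial.eval_C_mul, Polynomial.eval_X_pow]

/-- Along the line `η₀ + s • η` both moments are polynomials in `s`. Agreement for small `s` makes
them equal, and their top coefficients are the moments in direction `η`. -/
theorem integral_inner_pow_eq_of_eventually {μ ν : Measure Ω} [IsFiniteMeasure μ]
    [IsFiniteMeasure ν] {η₀ : E} {k : ℕ}
    (h : ∀ᶠ η in nhds η₀, ∫ x : Ω, (inner ℝ η (x : E)) ^ k ∂μ = ∫ x : Ω, (inner ℝ η (x : E)) ^ k ∂ν)
    (η : E) : ∫ x : Ω, (inner ℝ η (x : E)) ^ k ∂μ = ∫ x : Ω, (inner ℝ η (x : E)) ^ k ∂ν := by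
  have hc : Continuous fun s : ℝ => η₀ + s • η := by fun_prop
  have hs : ∀ᶠ s in nhds (0 : ℝ), ∫ x : Ω, (inner ℝ (η₀ + s • η) (x : E)) ^ k ∂μ
      = ∫ x : Ω, (inner ℝ (η₀ + s • η) (x : E)) ^ k ∂ν := by
    have h0 : Filter.Tendsto (fun s : ℝ => η₀ + s • η) (nhds 0) (nhds η₀) := by
      simpa using hc.tendsto 0
    exact h0.eventually h
  have hp : momentPolynomial μ η₀ η k = momentPolynomial ν η₀ η k := by
    refine Polynomial.eq_of_infinite_eval_eq _ _ ((infinite_of_mem_nhds _ hs).mono fun s hs => ?_)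
    change Polynomial.eval s _ = Polynomial.eval s _
    rw [eval_momentPolynomial, eval_momentPolynomial]
    exact hs
  rw [← coeff_momentPolynomial_self μ η₀, hp, coeff_momentPolynomial_self]

open Complex in
-- Compactness bounds `⟨t, x⟩` by some `C`, so the exponential series is dominated by `C ^ k / k!`
-- and can be integrated termwise.
theorem charFun_eq_tsum_moments (μ : Measure Ω) [IsFiniteMeasure μ] (t : E) :
    charFun (μ.map Subtype.val) t
      = ∑' k : ℕ, (I ^ k / (k.factorial : ℂ)) * ((∫ x : Ω, (inner ℝ t (x : E)) ^ k ∂μ : ℝ) : ℂ) := by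
  obtain ⟨C, hC⟩ := isCompact_univ.exists_bound_of_continuousOn
    (by fun_prop : Continuous fun x : Ω => inner ℝ t (x : E)).continuousOn
  rw [charFun_apply, integral_map measurable_subtype_coe.aemeasurable (by fun_prop)]
  have hexp : ∀ x : Ω, Complex.exp (inner ℝ (x : E) t * I)
      = ∑' k : ℕ, (I ^ k / (k.factorial : ℂ)) * ((inner ℝ t (x : E) ^ k : ℝ) : ℂ) := by
    intro x
    rw [Complex.exp_eq_exp_ℂ, NormedSpace.exp_eq_tsum_div]
    refine tsum_congr fun k => ?_
    rw [real_inner_comm, mul_pow]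
    push_cast
    ring
  simp_rw [hexp]
  have hint : ∀ k : ℕ, Integrable
      (fun x : Ω => (I ^ k / (k.factorial : ℂ)) * ((inner ℝ t (x : E) ^ k : ℝ) : ℂ)) μ := fun k =>
    integrable_of_continuous_compactSpace μ (by fun_prop)
  rw [← integral_tsum_of_summable_integral_norm hint]
  · refine tsum_congr fun k => ?_
    rw [integral_const_mul]
    congr 1
    exact integral_ofReal
  · refine Summable.of_nonneg_of_le (fun k => integral_nonneg fun x => norm_nonneg _)
      (f := fun k : ℕ => C ^ k / (k.factorial : ℝ) * μ.real Set.univ) (fun k => ?_)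
      ((Real.summable_pow_div_factorial C).mul_right _)
    rw [mul_comm, ← smul_eq_mul, ← integral_const]
    refine integral_mono (hint k).norm (integrable_const _) fun x => ?_
    have hx := hC x (Set.mem_univ x)
    simp only [norm_mul, norm_div, norm_pow, norm_I, one_pow, Complex.norm_natCast,
      Complex.norm_real]
    rw [one_div, inv_mul_eq_div]
    gcongr

variable [CompleteSpace E] [SecondCountableTopology E]

theorem measure_eq_of_forall_moments_eq {μ ν : Measure Ω} [IsFiniteMeasure μ]
    [IsFiniteMeasure ν] (hΩ : MeasurableSet Ω)
    (h : ∀ (k : ℕ) (η : E),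
      ∫ x : Ω, (inner ℝ η (x : E)) ^ k ∂μ = ∫ x : Ω, (inner ℝ η (x : E)) ^ k ∂ν) : μ = ν := by
  have hmap : μ.map (Subtype.val : Ω → E) = ν.map Subtype.val := by
    refine Measure.ext_of_charFun (funext fun t => ?_)
    rw [charFun_eq_tsum_moments, charFun_eq_tsum_moments]
    simp_rw [h]
  rw [← (MeasurableEmbedding.subtype_coe hΩ).comap_map μ, hmap,
    (MeasurableEmbedding.subtype_coe hΩ).comap_map ν]

/-- Injectivity of the limited-angle Radon transform on measures with compact support: directions
that are dense in a nonempty open part of the sphere suffice. -/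
theorem measure_eq_of_forall_map_inner_eq {μ ν : Measure Ω} [IsFiniteMeasure μ]
    [IsFiniteMeasure ν] (hΩ : MeasurableSet Ω) {U D : Set (Metric.sphere (0 : E) 1)}
    (hU : IsOpen U) (hne : U.Nonempty) (hD : U ⊆ closure D)
    (h : ∀ θ ∈ D, μ.map (fun x : Ω => inner ℝ (θ : E) (x : E))
      = ν.map (fun x : Ω => inner ℝ (θ : E) (x : E))) : μ = ν := by
  refine measure_eq_of_forall_moments_eq hΩ fun k => ?_
  have hDk : ∀ θ ∈ D, ∫ x : Ω, (inner ℝ (θ : E) (x : E)) ^ k ∂μ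
      = ∫ x : Ω, (inner ℝ (θ : E) (x : E)) ^ k ∂ν := by
    intro θ hθ
    have hm : ∀ ρ : Measure Ω, ∫ x : Ω, (inner ℝ (θ : E) (x : E)) ^ k ∂ρ
        = ∫ y, y ^ k ∂(ρ.map (fun x : Ω => inner ℝ (θ : E) (x : E))) := fun ρ => by
      rw [integral_map (by fun_prop) (by fun_prop)]
    rw [hm, hm, h θ hθ]
  -- Moments are continuous in the direction, so equality passes from `D` to its closure.
  have hUk : ∀ θ ∈ U, ∫ x : Ω, (inner ℝ (θ : E) (x : E)) ^ k ∂μ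
      = ∫ x : Ω, (inner ℝ (θ : E) (x : E)) ^ k ∂ν := by
    have hcl : IsClosed {θ : Metric.sphere (0 : E) 1 | ∫ x : Ω, (inner ℝ (θ : E) (x : E)) ^ k ∂μ
        = ∫ x : Ω, (inner ℝ (θ : E) (x : E)) ^ k ∂ν} :=
      isClosed_eq ((continuous_integral_inner_pow μ k).comp continuous_subtype_val)
        ((continuous_integral_inner_pow ν k).comp continuous_subtype_val)
    exact fun θ hθ => closure_minimal hDk hcl (hD hθ)
  obtain ⟨θ, hθ⟩ := hne
  obtain ⟨W, hW, rfl⟩ := isOpen_induced_iff.1 hU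
  have hθn : ‖(θ : E)‖ = 1 := by simp
  have hθ0 : (θ : E) ≠ 0 := by
    intro h
    simp [h] at hθn
  apply integral_inner_pow_eq_of_eventually (η₀ := (θ : E))
  -- Normalizing `η` extends the equality from an open part of the sphere to a neighbourhood in `E`,
  -- since the moments are homogeneous of degree `k`.
  have hcont : ContinuousAt (fun η : E => ‖η‖⁻¹ • η) (θ : E) :=
    (continuousAt_id.norm.inv₀ (by simp)).smul continuousAt_id
  have hW' : ∀ᶠ η : E in nhds (θ : E), ‖η‖⁻¹ • η ∈ W := by
    apply hcont.eventually_mem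
    simpa [hθn] using hW.mem_nhds hθ
  filter_upwards [hW', isOpen_ne.mem_nhds hθ0] with η hη hη0
  have hη0' : ‖η‖ ≠ 0 := norm_ne_zero_iff.2 hη0
  have key := hUk ⟨‖η‖⁻¹ • η, by simp [norm_smul, hη0']⟩ hη
  simp only [inner_smul_left, conj_trivial, mul_pow, integral_const_mul] at key
  exact mul_left_cancel₀ (pow_ne_zero k (inv_ne_zero hη0')) key

end Moments

/-! ### Generic directions -/

section Genericity

variable {d : ℕ} {Θ : Set (Sphere d)}

/-- Each nonzero `z` excludes a great subsphere, null for the surface measure and hence for `HΘ`;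
countably many are still null. -/
theorem ae_inner_eq_zero_imp {HΘ : Measure Θ} (hdens : HasLowerSemicontinuousDensity HΘ)
    {Z : Set (Space d)} (hZ : Z.Countable) :
    ∀ᵐ θ ∂HΘ, ∀ z ∈ Z, inner ℝ (θ.1 : Space d) z = 0 → z = 0 := by
  obtain ⟨ρ, -, -, hmap⟩ := hdens
  rw [ae_ball_iff hZ]
  intro z _
  by_cases hz : z = 0
  · exact Filter.Eventually.of_forall fun _ _ => hz
  have h0 : ∀ᵐ θ : Sphere d ∂(HΘ.map (Subtype.val : Θ → Sphere d)),
      inner ℝ (θ.1 : Space d) z ≠ 0 := by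
    rw [hmap]
    refine (withDensity_absolutelyContinuous _ _).ae_le ?_
    have h := hausdorffMeasure_sphere_inter_orthogonal hz
    rw [finrank_euclideanSpace_fin] at h
    exact measure_eq_zero_iff_ae_notMem.1 h
  filter_upwards [ae_of_ae_map measurable_subtype_coe.aemeasurable h0] with θ hθ h
  exact absurd h hθ

/-- Take `U = {ρ > 0}`, open by lower semicontinuity. A nonempty open piece of `U` has positive
surface measure and positive density, so it cannot miss a set of full `HΘ`-measure. -/
theorem exists_isOpen_subset_closure_of_ae {HΘ : Measure Θ}
    (hdens : HasLowerSemicontinuousDensity HΘ) :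
    ∃ U : Set (Sphere d), IsOpen U ∧ U.Nonempty ∧ ∀ D : Set Θ, (∀ᵐ θ ∂HΘ, θ ∈ D) →
      U ⊆ closure (Subtype.val '' D) := by
  obtain ⟨ρ, hρ, hρ0, hmap⟩ := hdens
  refine ⟨{θ | 0 < ρ θ}, hρ.isOpen_preimage 0, ?_, fun D hD θ hθ => ?_⟩
  · obtain ⟨θ, hθ⟩ := Function.ne_iff.1 hρ0
    exact ⟨θ, pos_iff_ne_zero.2 hθ⟩
  rw [mem_closure_iff]
  intro V hV hθV
  by_contra hne
  rw [Set.not_nonempty_iff_eq_empty] at hne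
  have hVU : IsOpen (V ∩ {θ | 0 < ρ θ}) := hV.inter (hρ.isOpen_preimage 0)
  have h0 : HΘ.map (Subtype.val : Θ → Sphere d) (V ∩ {θ | 0 < ρ θ}) = 0 := by
    rw [Measure.map_apply measurable_subtype_coe hVU.measurableSet]
    refine measure_mono_null (t := {η | ¬ η ∈ D}) (fun η hη hηD => ?_) (ae_iff.1 hD)
    have : (η : Sphere d) ∈ V ∩ Subtype.val '' D := ⟨hη.1, η, hηD, rfl⟩
    rw [hne] at this
    exact this
  rw [hmap, withDensity_apply_eq_zero hρ.measurable] at h0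
  have hset : {θ | ρ θ ≠ 0} ∩ (V ∩ {θ | 0 < ρ θ}) = V ∩ {θ | 0 < ρ θ} :=
    Set.inter_eq_right.2 fun η hη => hη.2.ne'
  rw [hset] at h0
  have := hausdorffMeasure_sphere_pos_of_isOpen hVU ⟨θ, hθV, hθ⟩
  rw [finrank_euclideanSpace_fin] at this
  exact this h0

end Genericity

/-! ### Coincidences and ghost particles under projection -/

section Particles

variable {d : ℕ}

theorem DimReduced.ParticleConfig.support_subset_range {Y : Type*} [TopologicalSpace Y] [T1Space Y]
    [MeasurableSpace Y] [BorelSpace Y] (P : ParticleConfig Y) :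
    (P.toMeasure : Measure Y).support ⊆ Set.range P.point :=
  Measure.support_subset_of_isClosed (Set.finite_range _).isClosed
    (ae_sum_smul_diracM P.mass P.point)

variable (P : ParticleConfig (Space d × Space d))

theorem DimReduced.ParticleConfig.exists_eq_point_of_not_hasGhostParticle {T' : Set ℝ}
    (hP : ¬ P.HasGhostParticle T') {p : Space d × Space d}
    (hp : ∀ t ∈ T', ∃ i, p.1 + t • p.2 = P.location t i) : ∃ i, p = P.point i := by
  by_contra hne
  refine hP ⟨p, fun hmem => hne ?_, hp⟩
  obtain ⟨i, hi⟩ := P.support_subset_range hmem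
  exact ⟨i, hi.symm⟩

/-- A single observation time admits ghost particles, unless there is no particle. -/
theorem DimReduced.ParticleConfig.nontrivial_of_not_hasGhostParticle {T' : Set ℝ}
    (hne : T'.Nonempty) (hP : ¬ P.HasGhostParticle T') {e : Space d} (he : e ≠ 0) (i₀ : Fin P.N) :
    T'.Nontrivial := by
  obtain ⟨t₀, ht₀⟩ := hne
  by_contra hnt
  rw [Set.not_nontrivial_iff] at hnt
  -- Lines of every velocity `r • e` pass through the location of particle `i₀` at time `t₀`;
  -- without ghosts these infinitely many lines would all be among finitely many particles.
  have h : ∀ r : ℝ, ∃ i, (P.location t₀ i₀ - t₀ • r • e, r • e) = P.point i := fun r => by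
    refine P.exists_eq_point_of_not_hasGhostParticle hP fun t ht => ⟨i₀, ?_⟩
    rw [hnt ht ht₀]
    simp
  choose i hi using h
  refine not_injective_infinite_finite i fun r r' hrr => ?_
  have h1 : r • e = r' • e := by
    have h2 := (hi r).trans ((congrArg P.point hrr).trans (hi r').symm)
    exact congrArg Prod.snd h2
  exact smul_left_injective ℝ he h1

/-- For directions outside countably many hyperplanes, the projection of a configuration without
coincidences and ghost particles has neither coincidences nor ghost particles. -/
theorem DimReduced.ParticleConfig.exists_countable_forall_projection {T' : Set ℝ}
    (hT' : T'.Countable) (hne : T'.Nonempty) (hco : ∀ t ∈ T', ¬ P.HasCoincidence t)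
    (hgh : ¬ P.HasGhostParticle T') :
    ∃ Z : Set (Space d), Z.Countable ∧ ∀ θ : Space d, θ ≠ 0 →
      (∀ z ∈ Z, inner ℝ θ z = 0 → z = 0) →
      (∀ t ∈ T', Function.Injective fun i => (inner ℝ θ (P.location t i) : ℝ)) ∧
      ∀ q : ℝ × ℝ, (∀ t ∈ T', ∃ i, q.1 + t * q.2 = inner ℝ θ (P.location t i)) →
        ∃ i, q = (inner ℝ θ (P.point i).1, inner ℝ θ (P.point i).2) := by
  have : Countable T' := hT'
  -- `A` vanishes exactly at a shared location. For distinct first two times, `B` vanishes exactly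
  -- when the third space-time point lies on the line through the other two.
  let A : T' × Fin P.N × Fin P.N → Space d := fun a => P.location a.1 a.2.1 - P.location a.1 a.2.2
  let B : T' × T' × T' × Fin P.N × Fin P.N × Fin P.N → Space d := fun a =>
    (a.2.1 - a.2.2.1 : ℝ) • P.location a.1 a.2.2.2.1 + (a.2.2.1 - a.1 : ℝ) •
      P.location a.2.1 a.2.2.2.2.1 - (a.2.1 - a.1 : ℝ) • P.location a.2.2.1 a.2.2.2.2.2
  refine ⟨Set.range A ∪ Set.range B, (Set.countable_range _).union (Set.countable_range _),
    fun θ hθ hZ => ⟨fun t ht i j hij => ?_, fun q hq => ?_⟩⟩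
  · by_contra hne
    refine hco t ht ⟨i, j, hne, ?_⟩
    have := hZ (A (⟨t, ht⟩, i, j)) (Or.inl ⟨_, rfl⟩) (by
      simp only [A, inner_sub_right]
      exact sub_eq_zero.2 hij)
    exact sub_eq_zero.1 this
  · choose i hi using hq
    obtain ⟨t₀, ht₀⟩ := hne
    obtain ⟨t₁, ht₁, t₂, ht₂, h12⟩ :=
      P.nontrivial_of_not_hasGhostParticle ⟨t₀, ht₀⟩ hgh hθ (i t₀ ht₀)
    have h21 : t₂ - t₁ ≠ 0 := sub_ne_zero.2 h12.symm
    set a := P.location t₁ (i t₁ ht₁) with ha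
    set b := P.location t₂ (i t₂ ht₂) with hb
    -- The line through the locations met at times `t₁` and `t₂` is the candidate lift of `q`. Three
    -- points of the projected line satisfy the affine relation of `B`, and genericity of `θ` lifts
    -- that relation to `Space d`.
    let v : Space d := (t₂ - t₁)⁻¹ • (b - a)
    let x : Space d := a - t₁ • v
    have hloc : ∀ t (ht : t ∈ T'), x + t • v = P.location t (i t ht) := by
      intro t ht
      have hz := hZ (B (⟨t₁, ht₁⟩, ⟨t₂, ht₂⟩, ⟨t, ht⟩, i t₁ ht₁, i t₂ ht₂, i t ht))
        (Or.inr ⟨_, rfl⟩) (by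
          simp only [B, inner_sub_right, inner_add_right, inner_smul_right]
          rw [← hi t₁ ht₁, ← hi t₂ ht₂, ← hi t ht]
          ring)
      have hz' : (t₂ - t) • a + (t - t₁) • b = (t₂ - t₁) • P.location t (i t ht) :=
        sub_eq_zero.1 hz
      have h3 : (t₂ - t₁) • (x + t • v) = (t₂ - t) • a + (t - t₁) • b := by
        simp only [x, v]
        match_scalars <;> field_simp <;> ring
      exact smul_right_injective _ h21 (h3.trans hz')
    obtain ⟨j, hj⟩ := P.exists_eq_point_of_not_hasGhostParticle hgh (p := (x, v))
      fun t ht => ⟨i t ht, hloc t ht⟩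
    refine ⟨j, ?_⟩
    rw [← hj]
    have e1 : q.1 + t₁ * q.2 = inner ℝ θ x + t₁ * inner ℝ θ v := by
      rw [hi t₁ ht₁, ← hloc t₁ ht₁, inner_add_right, inner_smul_right]
    have e2 : q.1 + t₂ * q.2 = inner ℝ θ x + t₂ * inner ℝ θ v := by
      rw [hi t₂ ht₂, ← hloc t₂ ht₂, inner_add_right, inner_smul_right]
    have e3 : q.2 = inner ℝ θ v := by
      apply mul_left_cancel₀ h21
      linarith
    have e4 : q.1 = inner ℝ θ x := by
      rw [e3] at e1
      linarith
    exact Prod.ext e4 e3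

end Particles

/-! ### Uniqueness of disintegrations -/

section Disintegration

/-- For a fixed set the slice values agree almost everywhere. A countable generating algebra permits
one common null set, and a π-system argument then identifies the measures. -/
theorem DimReduced.IsDisintegration.ae_eq {d : ℕ} {Θ : Set (Sphere d)} {Y : Type*}
    [MeasurableSpace Y] [MeasurableSpace.CountablyGenerated Y] {HΘ : Measure Θ} [SigmaFinite HΘ]
    {γ : FiniteMeasure (Θ × Y)} {κ κ' : Θ → FiniteMeasure Y} (h : IsDisintegration HΘ γ κ)
    (h' : IsDisintegration HΘ γ κ') : κ =ᵐ[HΘ] κ' := by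
  have hB : ∀ B : Set Y, MeasurableSet B →
      ∀ᵐ θ ∂HΘ, (κ θ : Measure Y) B = (κ' θ : Measure Y) B := fun B hB =>
    ae_eq_of_forall_setLIntegral_eq_of_sigmaFinite₀ (h.1 B hB) (h'.1 B hB) fun A hA _ => by
      rw [← h.2 A B hA hB, ← h'.2 A B hA hB]
  let 𝒜 := generateSetAlgebra (MeasurableSpace.countableGeneratingSet Y)
  have hgen : MeasurableSpace.generateFrom 𝒜 = ‹MeasurableSpace Y› := by
    rw [generateFrom_generateSetAlgebra_eq]
    exact MeasurableSpace.generateFrom_countableGeneratingSet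
  have hpi : IsPiSystem 𝒜 := fun s hs t ht _ => isSetAlgebra_generateSetAlgebra.inter_mem hs ht
  have hc : 𝒜.Countable :=
    countable_generateSetAlgebra MeasurableSpace.countable_countableGeneratingSet
  have hmeas : ∀ B ∈ 𝒜, MeasurableSet B := fun B hB => by
    rw [← hgen]
    exact MeasurableSpace.measurableSet_generateFrom hB
  filter_upwards [(ae_ball_iff hc).2 fun B hBA => hB B (hmeas B hBA), hB _ MeasurableSet.univ]
    with θ hθ huniv
  exact FiniteMeasure.toMeasure_injective (ext_of_generate_finite 𝒜 hgen.symm hpi hθ huniv)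

end Disintegration

/-! ### Feasibility of the ground truth and exact recovery -/

section Models

variable {d : ℕ} {Ω : Set (Space d)} {S : Set ℝ} {Θ : Set (Sphere d)}

theorem mass_map_eq {X Y : Type*} [MeasurableSpace X] [MeasurableSpace Y] (u : FiniteMeasure X)
    {f : X → Y} (hf : Measurable f) : (u.map f).mass = u.mass := by
  rw [← ENNReal.coe_inj, FiniteMeasure.ennreal_mass, FiniteMeasure.ennreal_mass,
    FiniteMeasure.toMeasure_map, Measure.map_apply hf MeasurableSet.univ, Set.preimage_univ]

theorem mass_radon (θ : Θ) (u : FiniteMeasure Ω) : (radon θ u).mass = u.mass :=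
  mass_map_eq u (by fun_prop)

theorem mass_moveLine (t : ℝ) (g : FiniteMeasure (Gam Ω S Θ)) : (moveLine t g).mass = g.mass :=
  mass_map_eq g (by fun_prop)

variable (lam : ParticleConfig (Lam Ω S))

/-- The projection `(θ · x_i, θ · v_i)` of particle `i`. -/
noncomputable def projectedPoint (θ : Θ) (i : Fin lam.N) : Gam Ω S Θ :=
  ⟨(inner ℝ (θ.1 : Space d) (lam.point i).1.1, inner ℝ (θ.1 : Space d) (lam.point i).1.2),
    ⟨(lam.point i).1, (lam.point i).2, θ.1, θ.2, rfl⟩⟩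

theorem continuous_projectedPoint (i : Fin lam.N) :
    Continuous fun θ : Θ => projectedPoint lam θ i := by
  unfold projectedPoint
  fun_prop

theorem trueProjection_eq (θ : Θ) :
    trueProjection lam θ = ∑ i, lam.mass i • diracM (projectedPoint lam θ i) :=
  map_sum_smul_diracM _ _ (by fun_prop)

theorem mass_trueProjection (θ : Θ) : (trueProjection lam θ).mass = ∑ i, lam.mass i := by
  rw [trueProjection_eq, mass_sum_smul_diracM]

theorem trueSnapshot_eq (t : S) : trueSnapshot lam t = ∑ i, lam.mass i • diracM
    (⟨(lam.point i).1.1 + (t : ℝ) • (lam.point i).1.2, (lam.point i).2 t t.2⟩ : Ω) :=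
  map_sum_smul_diracM _ _ (by fun_prop)

theorem mass_trueSnapshot (t : S) : (trueSnapshot lam t).mass = ∑ i, lam.mass i := by
  rw [trueSnapshot_eq, mass_sum_smul_diracM]

theorem radon_trueSnapshot (t : S) (θ : Θ) :
    radon θ (trueSnapshot lam t) = ∑ i, lam.mass i • diracM
      (inner ℝ (θ.1 : Space d) ((lam.map Subtype.val).location t i) : ℝ) := by
  rw [trueSnapshot_eq, radon, map_sum_smul_diracM _ _ (by fun_prop)]
  rfl

theorem moveLine_trueProjection (t : S) (θ : Θ) :
    moveLine t (trueProjection lam θ) = radon θ (trueSnapshot lam t) := by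
  rw [radon_trueSnapshot, trueProjection_eq, moveLine, map_sum_smul_diracM _ _ (by fun_prop)]
  refine Finset.sum_congr rfl fun i _ => ?_
  congr 2
  simp only [projectedPoint, ParticleConfig.location, ParticleConfig.map, inner_add_right,
    inner_smul_right]
  rfl

/-- In a direction whose projection has neither coincidences nor ghost particles, the projected
measure is determined by its moves. -/
theorem eq_trueProjection_of_moveLine_eq {T' : Set ℝ} (hT' : T'.Countable) (hne : T'.Nonempty)
    (hTS : T' ⊆ S) (θ : Θ)
    (hinj : ∀ t ∈ T', Function.Injective fun i =>
      (inner ℝ (θ.1 : Space d) ((lam.map Subtype.val).location t i) : ℝ))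
    (hgh : ∀ q : ℝ × ℝ, (∀ t ∈ T', ∃ i, q.1 + t * q.2
        = inner ℝ (θ.1 : Space d) ((lam.map Subtype.val).location t i)) →
      ∃ i, q = (inner ℝ (θ.1 : Space d) ((lam.map Subtype.val).point i).1,
        inner ℝ (θ.1 : Space d) ((lam.map Subtype.val).point i).2))
    {g : FiniteMeasure (Gam Ω S Θ)}
    (hg : ∀ t : S, (t : ℝ) ∈ T' → moveLine t g = radon θ (trueSnapshot lam t)) :
    g = trueProjection lam θ := by
  have hmove : ∀ (t : S) (i : Fin lam.N),
      (projectedPoint lam θ i).1.1 + (t : ℝ) * (projectedPoint lam θ i).1.2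
        = inner ℝ (θ.1 : Space d) ((lam.map Subtype.val).location t i) := by
    intro t i
    simp only [projectedPoint, ParticleConfig.location, ParticleConfig.map, inner_add_right,
      inner_smul_right]
    rfl
  have hmeas : ∀ t : ℝ, Measurable fun q : Gam Ω S Θ => q.1.1 + t * q.1.2 := fun t => by fun_prop
  have hconc : ∀ᵐ q ∂(g : Measure (Gam Ω S Θ)), q ∈ Set.range (projectedPoint lam θ) := by
    -- At each time in `T'` the moved measure lives on the projected locations. Countability of `T'`
    -- gives this for all times at once, and absence of projected ghosts then places `q` on a
    -- projected particle.
    have h1 : ∀ᵐ q ∂(g : Measure (Gam Ω S Θ)), ∀ t ∈ T', ∃ i, q.1.1 + t * q.1.2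
        = inner ℝ (θ.1 : Space d) ((lam.map Subtype.val).location t i) := by
      rw [ae_ball_iff hT']
      intro t ht
      have h2 := ae_sum_smul_diracM lam.mass fun i =>
        (inner ℝ (θ.1 : Space d) ((lam.map Subtype.val).location t i) : ℝ)
      rw [← radon_trueSnapshot lam ⟨t, hTS ht⟩ θ, ← hg ⟨t, hTS ht⟩ ht] at h2
      filter_upwards [ae_of_ae_map (hmeas t).aemeasurable h2] with q hq
      obtain ⟨i, hi⟩ := hq
      exact ⟨i, hi.symm⟩
    filter_upwards [h1] with q hq
    obtain ⟨i, hi⟩ := hgh q.1 hq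
    exact ⟨i, Subtype.ext hi.symm⟩
  obtain ⟨t₀, ht₀⟩ := hne
  have hpinj : Function.Injective (projectedPoint lam θ) := by
    intro i j hij
    apply hinj t₀ ht₀
    change inner ℝ (θ.1 : Space d) ((lam.map Subtype.val).location t₀ i)
      = inner ℝ (θ.1 : Space d) ((lam.map Subtype.val).location t₀ j)
    rw [← hmove ⟨t₀, hTS ht₀⟩ i, ← hmove ⟨t₀, hTS ht₀⟩ j, hij]
  rw [trueProjection_eq]
  refine eq_sum_smul_diracM hpinj hconc fun i => ?_
  have h1 := sum_smul_diracM_singleton lam.mass (hinj t₀ ht₀) i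
  rw [← h1, ← radon_trueSnapshot lam ⟨t₀, hTS ht₀⟩ θ, ← hg ⟨t₀, hTS ht₀⟩ ht₀, moveLine,
    FiniteMeasure.toMeasure_map, Measure.map_apply (hmeas t₀) (measurableSet_singleton _)]
  -- Up to a null set, the only point moved to location `i` at time `t₀` is projected particle `i`,
  -- because the projected locations are distinct.
  refine measure_congr ?_
  filter_upwards [hconc] with q hq
  obtain ⟨j, rfl⟩ := hq
  refine propext ?_
  change projectedPoint lam θ j = projectedPoint lam θ i ↔
    (projectedPoint lam θ j).1.1 + t₀ * (projectedPoint lam θ j).1.2 = _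
  rw [hmove ⟨t₀, hTS ht₀⟩ j, hpinj.eq_iff]
  exact (hinj t₀ ht₀).eq_iff.symm

variable {H : Type*} [NormedAddCommGroup H] [InnerProductSpace ℝ H]

/-- Exact recovery from snapshots and projections that are compatible in almost all directions. -/
theorem eq_groundTruth_of_mass_le (hΩ : IsCompact Ω) {T : Set ℝ} (hT : T.Countable) (hTS : T ⊆ S)
    {Ob : S → ObservationOperator Ω H} {HΘ : Measure Θ} [NeZero HΘ]
    (hdens : HasLowerSemicontinuousDensity HΘ)
    {lam : ParticleConfig (Lam Ω S)} (hreg : GroundTruthRegular lam T Ob)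
    {u : S → FiniteMeasure Ω} {κ : Θ → FiniteMeasure (Gam Ω S Θ)}
    (hcomp : ∀ t : S, ∀ᵐ θ ∂HΘ, moveLine t (κ θ) = radon θ (u t))
    (hobs : ∀ t : S, (t : ℝ) ∈ T → (Ob t).observe (u t) = trueData lam Ob t)
    (hmass : ∀ t : S, (u t).mass ≤ ∑ i, lam.mass i) :
    (∀ t : S, u t = trueSnapshot lam t) ∧ ∀ᵐ θ ∂HΘ, κ θ = trueProjection lam θ := by
  obtain ⟨T', hT'T, hne, hrec, hco, hgh⟩ := hreg
  have : CompactSpace Ω := isCompact_iff_compactSpace.1 hΩ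
  have hT' : T'.Countable := hT.mono hT'T
  have hu : ∀ t : S, (t : ℝ) ∈ T' → u t = trueSnapshot lam t := fun t ht =>
    (hrec t ht).eq_of_observe_eq ((hmass t).trans_eq (mass_trueSnapshot lam t).symm)
      (hobs t (hT'T ht))
  obtain ⟨Z, hZ, hproj⟩ :=
    (lam.map Subtype.val).exists_countable_forall_projection hT' hne hco hgh
  have hcomp' : ∀ᵐ θ ∂HΘ, ∀ t (ht : t ∈ T'),
      moveLine t (κ θ) = radon θ (u ⟨t, hTS (hT'T ht)⟩) :=
    (ae_ball_iff hT').2 fun t ht => hcomp ⟨t, hTS (hT'T ht)⟩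
  have hκ : ∀ᵐ θ ∂HΘ, κ θ = trueProjection lam θ := by
    filter_upwards [ae_inner_eq_zero_imp hdens hZ, hcomp'] with θ hθZ hθ
    have hθ0 : (θ.1 : Space d) ≠ 0 := ne_zero_of_mem_unit_sphere θ.1
    obtain ⟨hinj, hghost⟩ := hproj θ.1 hθ0 hθZ
    refine eq_trueProjection_of_moveLine_eq lam hT' hne (hT'T.trans hTS) θ hinj hghost
      fun t ht => ?_
    rw [hθ t ht, hu t ht]
  refine ⟨fun t => ?_, hκ⟩
  obtain ⟨U, hU, hUne, hUD⟩ := exists_isOpen_subset_closure_of_ae hdens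
  -- The time `t` is fixed here: the exceptional null set of directions may depend on `t`, and `S`
  -- may be uncountable.
  have hD : ∀ᵐ θ ∂HΘ, θ ∈ {θ : Θ | radon θ (u t) = radon θ (trueSnapshot lam t)} := by
    filter_upwards [hκ, hcomp t] with θ h1 h2
    rw [← h2, h1, moveLine_trueProjection]
  apply FiniteMeasure.toMeasure_injective
  refine measure_eq_of_forall_map_inner_eq hΩ.measurableSet hU hUne (hUD _ hD) ?_
  rintro _ ⟨θ, hθ, rfl⟩
  exact congrArg (fun m : FiniteMeasure ℝ => (m : Measure ℝ)) hθ

/-- The ground truth projections as a measure on `Θ × Γ`. -/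
noncomputable def trueMixedProjection (HΘ : Measure Θ) [IsFiniteMeasure HΘ] :
    FiniteMeasure (Θ × Gam Ω S Θ) :=
  ∑ i, lam.mass i • FiniteMeasure.map (⟨HΘ, inferInstance⟩ : FiniteMeasure Θ)
    fun θ => (θ, projectedPoint lam θ i)

theorem trueMixedProjection_prod (HΘ : Measure Θ) [IsFiniteMeasure HΘ] {A : Set Θ}
    {B : Set (Gam Ω S Θ)} (hA : MeasurableSet A) (hB : MeasurableSet B) :
    (trueMixedProjection lam HΘ : Measure (Θ × Gam Ω S Θ)) (A ×ˢ B)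
      = ∑ i, lam.mass i * HΘ ((fun θ => projectedPoint lam θ i) ⁻¹' B ∩ A) := by
  rw [trueMixedProjection, FiniteMeasure.toMeasure_sum, Measure.finsetSum_apply]
  refine Finset.sum_congr rfl fun i _ => ?_
  have hm : Measurable fun θ : Θ => (θ, projectedPoint lam θ i) :=
    measurable_id.prodMk (continuous_projectedPoint lam i).measurable
  have h1 : (HΘ.map fun θ : Θ => (θ, projectedPoint lam θ i)) (A ×ˢ B)
      = HΘ ((fun θ => projectedPoint lam θ i) ⁻¹' B ∩ A) := by
    rw [Measure.map_apply hm (hA.prod hB), Set.inter_comm]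
    rfl
  rw [← h1]
  rfl

/-- Each particle contributes the image of `HΘ` on the graph of `θ ↦ projectedPoint lam θ i`, whose
slices are Dirac masses. This supplies the competitor in the mixed model. -/
theorem isDisintegration_trueMixedProjection (HΘ : Measure Θ) [IsFiniteMeasure HΘ] :
    IsDisintegration HΘ (trueMixedProjection lam HΘ) (trueProjection lam) := by
  have hval : ∀ B : Set (Gam Ω S Θ), MeasurableSet B → ∀ θ : Θ,
      (trueProjection lam θ : Measure (Gam Ω S Θ)) B = ∑ i, (lam.mass i : ℝ≥0∞) *
        ((fun θ => projectedPoint lam θ i) ⁻¹' B).indicator 1 θ := by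
    intro B hB θ
    rw [trueProjection_eq, sum_smul_dirac_apply _ _ hB]
    rfl
  have hmeas : ∀ (B : Set (Gam Ω S Θ)) (i : Fin lam.N), MeasurableSet B →
      MeasurableSet ((fun θ : Θ => projectedPoint lam θ i) ⁻¹' B) := fun B i hB =>
    (continuous_projectedPoint lam i).measurable hB
  have hmeas' : ∀ (B : Set (Gam Ω S Θ)) (i : Fin lam.N), MeasurableSet B →
      Measurable fun θ : Θ => (lam.mass i : ℝ≥0∞) *
        ((fun θ => projectedPoint lam θ i) ⁻¹' B).indicator 1 θ := fun B i hB =>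
    (measurable_one.indicator (hmeas B i hB)).const_mul _
  refine ⟨fun B hB => ?_, fun A B hA hB => ?_⟩
  · simp_rw [hval B hB]
    exact (Finset.measurable_fun_sum _ fun i _ => hmeas' B i hB).aemeasurable
  · rw [trueMixedProjection_prod lam HΘ hA hB]
    simp_rw [hval B hB]
    rw [lintegral_finsetSum _ fun i _ => hmeas' B i hB]
    refine Finset.sum_congr rfl fun i _ => ?_
    rw [lintegral_const_mul _ (measurable_one.indicator (hmeas B i hB)),
      lintegral_indicator_one (hmeas B i hB), Measure.restrict_apply (hmeas B i hB)]

theorem mass_eq_of_isDisintegration {Y : Type*} [MeasurableSpace Y] {HΘ : Measure Θ}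
    [IsProbabilityMeasure HΘ] {γ : FiniteMeasure (Θ × Y)} {κ : Θ → FiniteMeasure Y}
    (h : IsDisintegration HΘ γ κ) {c : ℝ≥0} (hc : ∀ᵐ θ ∂HΘ, (κ θ).mass = c) : γ.mass = c := by
  have h1 := h.2 Set.univ Set.univ MeasurableSet.univ MeasurableSet.univ
  rw [Set.univ_prod_univ, ← FiniteMeasure.ennreal_mass, Measure.restrict_univ] at h1
  rw [← ENNReal.coe_inj, h1]
  have h2 : ∀ᵐ θ ∂HΘ, (κ θ : Measure Y) Set.univ = c := by
    filter_upwards [hc] with θ hθ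
    rw [← FiniteMeasure.ennreal_mass, hθ]
  rw [lintegral_congr_ae h2, lintegral_const, measure_univ, mul_one]

end Models

/-! ### Both models -/

theorem mainTheorem2 {d : ℕ} {H : Type*} [NormedAddCommGroup H] [InnerProductSpace ℝ H]
    [CompleteSpace H]
    (Ω : Set (Space d)) (hΩ : IsCompact Ω)
    (S : Set ℝ) (hS : IsCompact S)
    (Θ : Set (Sphere d)) (hΘ : IsCompact Θ)
    (T : Set ℝ) (hT : T.Finite) (hTS : T ⊆ S)
    (Ob : S → ObservationOperator Ω H)
    (HΘ : Measure Θ) [IsProbabilityMeasure HΘ] (hdens : HasLowerSemicontinuousDensity HΘ)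
    (lam : ParticleConfig (Lam Ω S)) (hreg : GroundTruthRegular lam T Ob) :
    (∀ (θ₀ : Θ) (u : S → FiniteMeasure Ω) (γ : Θ → FiniteMeasure (Gam Ω S Θ)),
      SolvesProduct θ₀ T Ob (trueData lam Ob) u γ →
        (∀ t : S, u t = trueSnapshot lam t) ∧
        ∀ᵐ θ ∂HΘ, γ θ = trueProjection lam θ) ∧
    (∀ (u : S → FiniteMeasure Ω) (γ : FiniteMeasure (Θ × Gam Ω S Θ)),
      SolvesMixed HΘ T Ob (trueData lam Ob) u γ →
        (∀ t : S, u t = trueSnapshot lam t) ∧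
        ∀ κ : Θ → FiniteMeasure (Gam Ω S Θ), IsDisintegration HΘ γ κ →
          ∀ᵐ θ ∂HΘ, κ θ = trueProjection lam θ) := by

  refine ⟨fun θ₀ u γ hsol => ?_, fun u γ hsol => ?_⟩
  · obtain ⟨⟨hcomp, hobs⟩, hmin⟩ := hsol
    refine eq_groundTruth_of_mass_le hΩ hT.countable hTS hdens hreg
      (fun t => Filter.Eventually.of_forall (hcomp t)) hobs fun t => ?_
    have h := hmin (trueSnapshot lam) (trueProjection lam)
      ⟨moveLine_trueProjection lam, fun _ _ => rfl⟩
    -- The single slice at `θ₀` bounds every snapshot, as compatibility holds there at each time.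
    rwa [mass_trueProjection, ← mass_moveLine (t : ℝ), hcomp t θ₀, mass_radon] at h
  · obtain ⟨⟨⟨κ, hκ, hcomp⟩, hobs⟩, hmin⟩ := hsol
    have h := hmin (trueSnapshot lam) (trueMixedProjection lam HΘ)
      ⟨⟨trueProjection lam, isDisintegration_trueMixedProjection lam HΘ, fun t =>
        Filter.Eventually.of_forall fun θ => moveLine_trueProjection lam t θ⟩, fun _ _ => rfl⟩
    rw [mass_eq_of_isDisintegration (isDisintegration_trueMixedProjection lam HΘ)
      (Filter.Eventually.of_forall fun θ => mass_trueProjection lam θ)] at h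
    -- Almost every slice has the mass of `u t`, and `HΘ` is a probability measure, so this is the
    -- mass of `γ`.
    have hmass : ∀ t : S, (u t).mass ≤ ∑ i, lam.mass i := fun t => by
      have hc : ∀ᵐ θ ∂HΘ, (κ θ).mass = (u t).mass := by
        filter_upwards [hcomp t] with θ hθ
        rw [← mass_moveLine (t : ℝ), hθ, mass_radon]
      rwa [mass_eq_of_isDisintegration hκ hc] at h
    obtain ⟨hu, hκt⟩ := eq_groundTruth_of_mass_le hΩ hT.countable hTS hdens hreg hcomp hobs hmass
    refine ⟨hu, fun κ' hκ' => ?_⟩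
    filter_upwards [hκt, hκ.ae_eq hκ'] with θ h1 h2
    rw [← h2, h1]
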